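/- **Conventions.** Let $A$ be a unital C*-algebra. $\mathcal U(A)$ denotes its unitary group with the norm topology and basepoint $1_A$; all maps between unitary groups, and all homotopies between such maps, are continuous and basepoint-preserving. $M_n(A)$ is the C*-algebra of $n\times n$ matrices over $A$, with $M_n=M_n(\mathbb C)$ identified with $1_A\otimes M_n\subseteq M_n(A)$, and $e_{i,j}\in M_n$ are the standard matrix units. For $a\in A$ write $a\otimes 1_n=\mathrm{diag}(a,\dots,a)\in M_n(A)$ and $a\oplus 1_{n-1}=\mathrm{diag}(a,1,\dots,1)\in M_n(A)$. Both $M_n(M_m(A))$ and $M_m(M_n(A))$ are identified with $M_{mn}(A)$ by erasing the inner brackets. For integers $m,n\ge 1$ let $$Z_{m,n}(A)=\{f\in C([0,1],M_{mn}(A)) : f(0)=a\otimes 1_n,\ f(1)=b\otimes 1_m\ \text{for some } a\in M_m(A),\ b\in M_n(A)\},$$ which is identified with $A\otimes Z_{m,n}$, where $Z_{m,n}=Z_{m,n}(\mathbb C)$; the algebra $Z_{m,n}$ is called a prime dimension drop algebra if $m$ and $n$ are relatively prime. **Elementary maps.** A map $\mathcal W:\mathcal U(A)\to\mathcal U(A\otimes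 Z_{1,n})$ is *elementary* if there are continuous paths $W_1,\dots,W_n:[0,1]\to \mathbf{SU}_n$ with $W_j(0)=1_n$ and $W_j(1)^*e_{j,j}W_j(1)=e_{1,1}$ for each $j$, such that for all $u\in\mathcal U(A)$ and $t\in[0,1]$ $$\mathcal W(u;t)=\prod_{j=1}^n W_j(t)^*\,[1_n+(u-1)e_{j,j}]\,W_j(t)$$ (factors in the order $j=1,\dots,n$). Then $\mathcal W(u;0)=u\otimes 1_n$ and $\mathcal W(u;1)=u^n\oplus 1_{n-1}$. **Basic maps.** A map $\eta:\mathcal U(A)\to\mathcal U(A\otimes Z_{m,n})$ is *basic* if there are elementary maps $\mathcal W_0:\mathcal U(M_m(A))\to\mathcal U(M_m(A)\otimes Z_{1,n})$ and $\mathcal W_1:\mathcal U(M_n(A))\to\mathcal U(M_n(A)\otimes Z_{1,m})$ such that for all $u\in\mathcal U(A)$ $$\eta(u)(t)=\begin{cases}\mathcal W_0(u^m\oplus 1_{m-1};\,2t), & 0\le t\le 1/2,\\ \mathcal W_1(u^n\oplus 1_{n-1};\,2-2t), & 1/2\le t\le 1.\end{cases}$$ **Proposition 2.5.** Let $A$ be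 a unital C*-algebra and $Z_{m,n}$ a prime dimension drop algebra. Let $\iota:\mathcal U(A)\to\mathcal U(A\otimes Z_{m,n})$ be the natural embedding $\iota(u)=u\otimes 1_{Z_{m,n}}$, i.e. $\iota(u)$ is the constant function with value $u\otimes 1_{mn}$. Then every basic map $\eta:\mathcal U(A)\to\mathcal U(A\otimes Z_{m,n})$ is homotopic to $\iota$, through continuous basepoint-preserving maps $\mathcal U(A)\to\mathcal U(A\otimes Z_{m,n})$. -/

import Mathlib

open scoped unitInterval

noncomputable section

namespace DimensionDrop

attribute [local instance] CStarAlgebra.spectralOrder CStarAlgebra.spectralOrderedRing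

/-- `M_n(A)`, the C*-algebra of `n × n` matrices over a C*-algebra `A`. -/
abbrev Mat (n : ℕ) (A : Type*) : Type _ := CStarMatrix (Fin n) (Fin n) A

/-- The inclusion of the scalar matrices `M_n` into `M_n(A)` as `1_A ⊗ M_n`. -/
def scalars (n : ℕ) (A : Type*) [CStarAlgebra A] : Matrix (Fin n) (Fin n) ℂ →⋆ₐ[ℂ] Mat n A where
  toFun w := CStarMatrix.ofMatrix (w.map (algebraMap ℂ A))
  map_one' := by
    ext i j
    simp [Matrix.one_apply, CStarMatrix.one_apply]
  map_mul' v w := by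
    ext i j
    simp [Matrix.mul_apply, CStarMatrix.mul_apply]
  map_zero' := by ext i j; simp
  map_add' v w := by ext i j; simp
  commutes' c := by
    ext i j
    simp [Matrix.algebraMap_matrix_apply, CStarMatrix.algebraMap_apply]
  map_star' w := by
    ext i j
    simp only [CStarMatrix.star_apply, CStarMatrix.ofMatrix_apply, Matrix.map_apply,
      Matrix.star_apply, algebraMap_star_comm]

/-- The diagonal matrix `diag(d_1, …, d_n) ∈ M_n(A)`. -/
def diag {n : ℕ} {A : Type*} [CStarAlgebra A] (d : Fin n → A) : Mat n A :=
  CStarMatrix.ofMatrix (Matrix.diagonal d)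

theorem diag_apply {n : ℕ} {A : Type*} [CStarAlgebra A] (d : Fin n → A) (i j : Fin n) :
    diag d i j = if i = j then d i else 0 := rfl

theorem diag_one {n : ℕ} {A : Type*} [CStarAlgebra A] : diag (fun _ : Fin n => (1 : A)) = 1 := by
  ext i j
  simp [diag_apply, CStarMatrix.one_apply]

theorem diag_mul {n : ℕ} {A : Type*} [CStarAlgebra A] (d e : Fin n → A) :
    diag d * diag e = diag fun i => d i * e i := by
  ext i j
  simp only [diag_apply, CStarMatrix.mul_apply]
  by_cases h : i = j
  · simp [h]
  · simp [h]

theorem diag_star {n : ℕ} {A : Type*} [CStarAlgebra A] (d : Fin n → A) :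
    star (diag d) = diag fun i => star (d i) := by
  ext i j
  simp only [CStarMatrix.star_apply, diag_apply]
  by_cases h : i = j
  · simp [h]
  · simp [h, Ne.symm h]

/-- `a ↦ a ⊗ 1_n = diag(a, …, a) ∈ M_n(A)`. -/
def ampl (n : ℕ) (A : Type*) [CStarAlgebra A] : A →⋆ₐ[ℂ] Mat n A where
  toFun a := diag fun _ => a
  map_one' := diag_one
  map_mul' a b := (diag_mul _ _).symm
  map_zero' := by ext i j; simp [diag_apply]
  map_add' a b := by
    ext i j
    simp only [diag_apply, CStarMatrix.add_apply]
    split_ifs <;> simp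
  commutes' c := by
    ext i j
    simp [diag_apply, CStarMatrix.algebraMap_apply]
  map_star' a := (diag_star _).symm

theorem ampl_apply {n : ℕ} {A : Type*} [CStarAlgebra A] (a : A) (i j : Fin n) :
    ampl n A a i j = if i = j then a else 0 := rfl

/-- The position of an index `p < N = k * l` in an `l × l` array of blocks of size `k × k`:
`p = k * q + r` corresponds to `(q, r)`, where `q` is the number of the block and `r` the position
inside the block. -/
def blockIndex {k l N : ℕ} (h : k * l = N) : Fin N ≃ Fin l × Fin k :=
  (finCongr ((Nat.mul_comm l k).trans h).symm).trans finProdFinEquiv.symm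

theorem blockIndex_eq_iff {k l N : ℕ} (h : k * l = N) (p q : Fin N) :
    p = q ↔ (blockIndex h p).1 = (blockIndex h q).1 ∧ (blockIndex h p).2 = (blockIndex h q).2 := by
  rw [← Prod.ext_iff, (blockIndex h).injective.eq_iff]

/-- An `l × l` matrix of `k × k` blocks, read as one `kl × kl` matrix. -/
def flattenFun {k l N : ℕ} (h : k * l = N) {A : Type*} [CStarAlgebra A]
    (x : Mat l (Mat k A)) : Mat N A :=
  CStarMatrix.ofMatrix fun p q =>
    (x (blockIndex h p).1 (blockIndex h q).1) (blockIndex h p).2 (blockIndex h q).2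

theorem flattenFun_apply {k l N : ℕ} (h : k * l = N) {A : Type*} [CStarAlgebra A]
    (x : Mat l (Mat k A)) (p q : Fin N) : flattenFun h x p q =
      (x (blockIndex h p).1 (blockIndex h q).1) (blockIndex h p).2 (blockIndex h q).2 := rfl

theorem ite_mat_apply {k : ℕ} {A : Type*} [CStarAlgebra A] (c : Prop) [Decidable c] (x : Mat k A)
    (i j : Fin k) : (if c then x else 0) i j = if c then x i j else 0 := by
  split_ifs <;> rfl

theorem sum_mat_apply {k : ℕ} {A : Type*} [CStarAlgebra A] {ι : Type*} (s : Finset ι)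
    (f : ι → Mat k A) (i j : Fin k) : (∑ a ∈ s, f a) i j = ∑ a ∈ s, f a i j := by
  induction s using Finset.cons_induction with
  | empty => simp
  | cons a s ha ih => rw [Finset.sum_cons, Finset.sum_cons, CStarMatrix.add_apply, ih]

/-- The identification of `M_l(M_k(A))` with `M_{kl}(A)` by erasing the inner brackets, as a unital
*-homomorphism. -/
def flatten {k l N : ℕ} (h : k * l = N) (A : Type*) [CStarAlgebra A] :
    Mat l (Mat k A) →⋆ₐ[ℂ] Mat N A where
  toFun x := flattenFun h x
  map_one' := by
    ext p q
    rw [flattenFun_apply, CStarMatrix.one_apply, ite_mat_apply, CStarMatrix.one_apply,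
      CStarMatrix.one_apply]
    simp only [blockIndex_eq_iff h p q, ite_and]
  map_mul' x y := by
    ext p q
    simp only [CStarMatrix.mul_apply, sum_mat_apply, flattenFun_apply]
    rw [← Fintype.sum_prod_type' (f := fun a b =>
      (x (blockIndex h p).1 a) (blockIndex h p).2 b *
        (y a (blockIndex h q).1) b (blockIndex h q).2)]
    exact (Equiv.sum_comp (blockIndex h) fun c =>
      (x (blockIndex h p).1 c.1) (blockIndex h p).2 c.2 *
        (y c.1 (blockIndex h q).1) c.2 (blockIndex h q).2).symm
  map_zero' := rfl
  map_add' x y := rfl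
  commutes' c := by
    ext p q
    rw [flattenFun_apply, CStarMatrix.algebraMap_apply, ite_mat_apply,
      CStarMatrix.algebraMap_apply, CStarMatrix.algebraMap_apply]
    simp only [blockIndex_eq_iff h p q, ite_and]
  map_star' x := rfl

theorem flatten_apply {k l N : ℕ} (h : k * l = N) {A : Type*} [CStarAlgebra A]
    (x : Mat l (Mat k A)) (p q : Fin N) : flatten h A x p q =
      (x (blockIndex h p).1 (blockIndex h q).1) (blockIndex h p).2 (blockIndex h q).2 := rfl

/-- `(a ⊗ 1_k) ⊗ 1_l = a ⊗ 1_{kl}`. -/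
theorem flatten_ampl_ampl {k l N : ℕ} (h : k * l = N) {A : Type*} [CStarAlgebra A] (a : A) :
    flatten h A (ampl l (Mat k A) (ampl k A a)) = ampl N A a := by
  ext p q
  rw [flatten_apply, ampl_apply, ite_mat_apply, ampl_apply, ampl_apply]
  simp only [blockIndex_eq_iff h p q, ite_and]

theorem continuous_entry {n : ℕ} {A : Type*} [CStarAlgebra A] (i j : Fin n) :
    Continuous fun x : Mat n A => x i j :=
  continuous_apply_apply (ρ := fun _ _ => A) i j

theorem continuous_mat {X : Type*} [TopologicalSpace X] {n : ℕ} {A : Type*} [CStarAlgebra A]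
    {f : X → Mat n A} (hf : ∀ i j, Continuous fun x => f x i j) : Continuous f :=
  continuous_pi fun i => continuous_pi fun j => hf i j

theorem continuous_flatten {k l N : ℕ} (h : k * l = N) (A : Type*) [CStarAlgebra A] :
    Continuous (flatten h A) :=
  continuous_mat fun p q => (continuous_entry (blockIndex h p).2 (blockIndex h q).2).comp
    (continuous_entry (A := Mat k A) (blockIndex h p).1 (blockIndex h q).1)

theorem continuous_scalars (n : ℕ) (A : Type*) [CStarAlgebra A] : Continuous (scalars n A) :=
  continuous_mat fun i j => (algebraMapCLM ℂ A).continuous.comp (continuous_id.matrix_elem i j)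

theorem continuous_diag {X : Type*} [TopologicalSpace X] {n : ℕ} {A : Type*} [CStarAlgebra A]
    {f : X → Fin n → A} (hf : ∀ i, Continuous fun x => f x i) :
    Continuous fun x => diag (f x) :=
  continuous_mat fun i j => by
    simp only [diag_apply]
    split_ifs
    · exact hf i
    · exact continuous_const

/-- The dimension drop algebra `Z_{m,n}(A) ≅ A ⊗ Z_{m,n}`: the continuous functions
`f : [0, 1] → M_{mn}(A)` with `f(0) = a ⊗ 1_n` for some `a ∈ M_m(A)` and `f(1) = b ⊗ 1_m` for some
`b ∈ M_n(A)`. -/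
def dimensionDrop (A : Type*) [CStarAlgebra A] (m n : ℕ) {N : ℕ} (h : m * n = N) :
    StarSubalgebra ℂ C(I, Mat N A) where
  carrier := {f | (∃ a : Mat m A, f 0 = flatten h A (ampl n (Mat m A) a)) ∧
    ∃ b : Mat n A, f 1 = flatten ((Nat.mul_comm n m).trans h) A (ampl m (Mat n A) b)}
  mul_mem' := by
    rintro f g ⟨⟨a, ha⟩, b, hb⟩ ⟨⟨a', ha'⟩, b', hb'⟩
    exact ⟨⟨a * a', by simp [ha, ha']⟩, b * b', by simp [hb, hb']⟩
  add_mem' := by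
    rintro f g ⟨⟨a, ha⟩, b, hb⟩ ⟨⟨a', ha'⟩, b', hb'⟩
    exact ⟨⟨a + a', by simp [ha, ha']⟩, b + b', by simp [hb, hb']⟩
  algebraMap_mem' c :=
    ⟨⟨algebraMap ℂ _ c, by simp only [AlgHomClass.commutes]; rfl⟩,
      algebraMap ℂ _ c, by simp only [AlgHomClass.commutes]; rfl⟩
  star_mem' := by
    rintro f ⟨⟨a, ha⟩, b, hb⟩
    exact ⟨⟨star a, by simp [ha, map_star]⟩, star b, by simp [hb, map_star]⟩

/-- `U(Z_{m,n}(A))`, the unitary group of `Z_{m,n}(A) ≅ A ⊗ Z_{m,n}`, with the norm topology. -/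
abbrev UZ (A : Type*) [CStarAlgebra A] (m n : ℕ) {N : ℕ} (h : m * n = N) : Type _ :=
  unitary (dimensionDrop A m n h)

theorem UZ_continuous_eval (A : Type*) [CStarAlgebra A] (m n : ℕ) {N : ℕ} (h : m * n = N) :
    Continuous fun p : UZ A m n h × I => (p.1 : C(I, Mat N A)) p.2 := by
  fun_prop

/-- An element of `U(Z_{m,n}(A))` from a continuous path of unitaries with the right ends. -/
def mkUZ {A : Type*} [CStarAlgebra A] {m n N : ℕ} (h : m * n = N) (f : C(I, Mat N A))
    (hf : f ∈ dimensionDrop A m n h) (hu : ∀ t, f t ∈ unitary (Mat N A)) : UZ A m n h :=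
  ⟨⟨f, hf⟩, Unitary.mem_iff.2
    ⟨Subtype.ext (ContinuousMap.ext fun t => (Unitary.mem_iff.1 (hu t)).1),
      Subtype.ext (ContinuousMap.ext fun t => (Unitary.mem_iff.1 (hu t)).2)⟩⟩

theorem UZ_eval_mem {A : Type*} [CStarAlgebra A] {m n N : ℕ} {h : m * n = N} (f : UZ A m n h)
    (t : I) : (f : C(I, Mat N A)) t ∈ unitary (Mat N A) := by
  have h1 := congrArg (fun g : dimensionDrop A m n h => (g : C(I, Mat N A)) t)
    (Unitary.coe_star_mul_self f)
  have h2 := congrArg (fun g : dimensionDrop A m n h => (g : C(I, Mat N A)) t)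
    (Unitary.coe_mul_star_self f)
  exact Unitary.mem_iff.2 ⟨h1, h2⟩

/-- The natural embedding `ι : U(A) → U(A ⊗ Z_{m,n})`, `ι(u) = u ⊗ 1`: it sends `u` to the constant
function on `[0, 1]` with value `u ⊗ 1_{mn}`. -/
def iota (A : Type*) [CStarAlgebra A] (m n : ℕ) {N : ℕ} (h : m * n = N) :
    C(unitary A, UZ A m n h) where
  toFun u := mkUZ h (ContinuousMap.const I (ampl N A u))
    ⟨⟨ampl m A u, (flatten_ampl_ampl h _).symm⟩, ampl n A u, (flatten_ampl_ampl _ _).symm⟩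
    fun _ => Unitary.map_mem (ampl N A) u.2
  continuous_toFun := by
    refine Continuous.subtype_mk (Continuous.subtype_mk ?_ _) _
    exact ContinuousMap.continuous_const'.comp
      ((continuous_diag fun _ => continuous_id).comp continuous_subtype_val)

/-- A sequence `(W_1, …, W_n)` of `n` paths in `SU_n` with `W_j(0) = 1_n` and
`W_j(1)^* e_{j,j} W_j(1) = e_{1,1}` for each `j` (indices start at `0` here). -/
structure SUPaths (n : ℕ) where
  path : Fin n → C(I, Matrix.specialUnitaryGroup (Fin n) ℂ)
  path_zero : ∀ j, path j 0 = 1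
  path_one : ∀ j, star (path j 1 : Matrix (Fin n) (Fin n) ℂ) * Matrix.single j j 1 *
    (path j 1 : Matrix (Fin n) (Fin n) ℂ) = Matrix.single ⟨0, j.pos⟩ ⟨0, j.pos⟩ 1

/-- `1_n + (a - 1) e_{j,j} ∈ M_n(A)`. -/
def oneAt {n : ℕ} {A : Type*} [CStarAlgebra A] (j : Fin n) (a : A) : Mat n A :=
  1 + CStarMatrix.ofMatrix (Matrix.single j j (a - 1))

/-- `a ⊕ 1_{n-1} = diag(a, 1, …, 1) ∈ M_n(A)`. -/
def corner (n : ℕ) {A : Type*} [CStarAlgebra A] (a : A) : Mat n A :=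
  diag fun i => if (i : ℕ) = 0 then a else 1

theorem oneAt_eq {n : ℕ} {A : Type*} [CStarAlgebra A] (j : Fin n) (a : A) :
    oneAt j a = diag fun i => if i = j then a else 1 := by
  ext p q
  simp only [oneAt, diag_apply, CStarMatrix.add_apply, CStarMatrix.one_apply,
    CStarMatrix.ofMatrix_apply, Matrix.single_apply]
  by_cases h : p = q
  · subst h
    by_cases h' : p = j
    · simp [h']
    · simp [h', Ne.symm h']
  · have : ¬ (j = p ∧ j = q) := fun h' => h (h'.1.symm.trans h'.2)
    simp [h, this]

theorem corner_eq {n : ℕ} {A : Type*} [CStarAlgebra A] (h : 0 < n) (a : A) :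
    corner n a = oneAt ⟨0, h⟩ a := by
  rw [oneAt_eq, corner]
  simp only [Fin.ext_iff]

theorem scalars_apply {n : ℕ} {A : Type*} [CStarAlgebra A] (w : Matrix (Fin n) (Fin n) ℂ)
    (p q : Fin n) : scalars n A w p q = algebraMap ℂ A (w p q) := rfl

theorem oneAt_scalars {n : ℕ} {A : Type*} [CStarAlgebra A] (j : Fin n) (a : A) :
    oneAt j a = 1 + scalars n A (Matrix.single j j 1) * ampl n A (a - 1) := by
  rw [oneAt]
  congr 1
  ext p q
  simp only [CStarMatrix.mul_apply, scalars_apply, ampl_apply, CStarMatrix.ofMatrix_apply,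
    Matrix.single_apply]
  simp only [mul_ite, mul_zero, Finset.sum_ite_eq', Finset.mem_univ, if_true]
  split_ifs <;> simp

theorem scalars_comm_ampl {n : ℕ} {A : Type*} [CStarAlgebra A] (w : Matrix (Fin n) (Fin n) ℂ)
    (a : A) : ampl n A a * scalars n A w = scalars n A w * ampl n A a := by
  ext p q
  simp only [CStarMatrix.mul_apply, scalars_apply, ampl_apply]
  simp [Algebra.commutes]

theorem diag_mem_unitary {n : ℕ} {A : Type*} [CStarAlgebra A] {d : Fin n → A}
    (hd : ∀ i, d i ∈ unitary A) : diag d ∈ unitary (Mat n A) := by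
  rw [Unitary.mem_iff, diag_star, diag_mul, diag_mul]
  simp only [(Unitary.mem_iff.1 (hd _)).1, (Unitary.mem_iff.1 (hd _)).2, diag_one, and_self]

theorem oneAt_mem_unitary {n : ℕ} {A : Type*} [CStarAlgebra A] (j : Fin n) (u : unitary A) :
    oneAt j (u : A) ∈ unitary (Mat n A) := by
  rw [oneAt_eq]
  refine diag_mem_unitary fun i => ?_
  split_ifs
  exacts [u.2, one_mem _]

theorem corner_mem_unitary (n : ℕ) {A : Type*} [CStarAlgebra A] (u : unitary A) :
    corner n (u : A) ∈ unitary (Mat n A) := by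
  refine diag_mem_unitary fun i => ?_
  split_ifs
  exacts [u.2, one_mem _]

theorem corner_pow (n : ℕ) {A : Type*} [CStarAlgebra A] (a : A) (k : ℕ) :
    corner n a ^ k = corner n (a ^ k) := by
  induction k with
  | zero =>
    simp only [pow_zero, corner, ite_self]
    exact diag_one.symm
  | succ k ih =>
    rw [pow_succ, ih, corner, corner, diag_mul, corner]
    congr 1
    ext i
    split_ifs
    · rw [pow_succ]
    · rw [mul_one]

theorem flatten_corner_corner {k l N : ℕ} (h : k * l = N) {A : Type*} [CStarAlgebra A] (a : A) :
    flatten h A (corner l (corner k a)) = corner N a := by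
  have key : ∀ p : Fin N, (p : ℕ) = 0 ↔
      ((blockIndex h p).1 : ℕ) = 0 ∧ ((blockIndex h p).2 : ℕ) = 0 := by
    intro p
    have h1 : ((blockIndex h p).1 : ℕ) = p / k := rfl
    have h2 : ((blockIndex h p).2 : ℕ) = p % k := rfl
    rw [h1, h2]
    constructor
    · intro hp; simp [hp]
    · rintro ⟨h3, h4⟩
      rw [← Nat.div_add_mod (p : ℕ) k, h3, h4, mul_zero]
  have hite : ∀ (c : Prop) [Decidable c] (x y : Mat k A) (i j : Fin k),
      (if c then x else y) i j = if c then x i j else y i j := by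
    intro c _ x y i j
    split_ifs <;> rfl
  ext p q
  rw [flatten_apply]
  unfold corner
  rw [diag_apply, diag_apply, ite_mat_apply, hite, diag_apply, CStarMatrix.one_apply]
  simp only [key p, blockIndex_eq_iff h p q]
  split_ifs <;> simp_all

/-- The map `u ↦ u ⊕ 1_{n-1}` from `U(A)` to `U(M_n(A))`. -/
def cornerU (n : ℕ) (A : Type*) [CStarAlgebra A] : C(unitary A, unitary (Mat n A)) where
  toFun u := ⟨corner n u, corner_mem_unitary n u⟩
  continuous_toFun := by
    refine Continuous.subtype_mk (continuous_diag fun i => ?_) _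
    split_ifs
    exacts [continuous_subtype_val, continuous_const]

/-- The map `u ↦ u^k` from `U(A)` to `U(A)`. -/
def powU (k : ℕ) (A : Type*) [CStarAlgebra A] : C(unitary A, unitary A) where
  toFun u := u ^ k
  continuous_toFun := continuous_pow k

namespace SUPaths

variable {n : ℕ} (W : SUPaths n) {A : Type*} [CStarAlgebra A]

/-- The factor `W_j^*(t) [1_n + (u - 1) e_{j,j}] W_j(t)`. -/
def factor (j : Fin n) (u : A) (t : I) : Mat n A :=
  star (scalars n A (W.path j t)) * oneAt j u * scalars n A (W.path j t)

/-- `𝓦(u; t) = ∏_{j = 1}^n W_j^*(t) [1_n + (u - 1) e_{j,j}] W_j(t)`, the factors being multiplied in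
the order of increasing `j`. -/
def value (u : A) (t : I) : Mat n A :=
  ((List.finRange n).map fun j => W.factor j u t).prod

theorem factor_mem_unitary (j : Fin n) (u : unitary A) (t : I) :
    W.factor j (u : A) t ∈ unitary (Mat n A) := by
  have h : scalars n A (W.path j t) ∈ unitary (Mat n A) :=
    Unitary.map_mem (scalars n A)
      (Matrix.specialUnitaryGroup_le_unitaryGroup (W.path j t).2)
  exact mul_mem (mul_mem (Unitary.star_mem h) (oneAt_mem_unitary j u)) h

theorem value_mem_unitary (u : unitary A) (t : I) : W.value (u : A) t ∈ unitary (Mat n A) := by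
  refine list_prod_mem fun x hx => ?_
  obtain ⟨j, -, rfl⟩ := List.mem_map.1 hx
  exact W.factor_mem_unitary j u t

theorem factor_eq (j : Fin n) (u : A) (t : I) : W.factor j u t =
    1 + scalars n A (star (W.path j t : Matrix (Fin n) (Fin n) ℂ) * Matrix.single j j 1 *
      (W.path j t : Matrix (Fin n) (Fin n) ℂ)) * ampl n A (u - 1) := by
  have h : star (W.path j t : Matrix (Fin n) (Fin n) ℂ) * (W.path j t) = 1 :=
    (Unitary.mem_iff.1 (Matrix.specialUnitaryGroup_le_unitaryGroup (W.path j t).2)).1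
  rw [factor, oneAt_scalars, mul_add, add_mul, mul_one, ← map_star, ← map_mul, h, map_one,
    mul_assoc, mul_assoc, scalars_comm_ampl, map_mul, map_mul]
  simp only [mul_assoc]

/-- `𝓦(u; 1) = u^n ⊕ 1_{n-1}`. -/
theorem value_one (u : A) : W.value u 1 = corner n (u ^ n) := by
  have h : ∀ j ∈ List.finRange n, W.factor j u 1 = corner n u := fun j _ => by
    rw [factor_eq, path_one, ← oneAt_scalars, ← corner_eq]
  rw [value, List.map_congr_left h, List.map_const', List.prod_replicate, List.length_finRange,
    corner_pow]

/-- `𝓦(u; 0) = u ⊗ 1_n`. -/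
theorem value_zero (u : A) : W.value u 0 = ampl n A u := by
  have h : ∀ j ∈ List.finRange n, W.factor j u 0 = diag fun i => if i = j then u else 1 :=
    fun j _ => by
      rw [factor, path_zero, oneAt_eq]
      simp
  have h2 : ∀ l : List (Fin n), (l.map fun j => diag fun i => if i = j then u else 1).prod =
      diag fun i => (l.map fun j => if i = j then u else 1).prod := by
    intro l
    induction l with
    | nil => simpa using diag_one.symm
    | cons j l ih => simp [ih, diag_mul]
  rw [value, List.map_congr_left h, h2]
  change _ = diag fun _ => u
  congr 1
  ext i
  rw [List.prod_map_eq_pow_single i _ fun j hj _ => by rw [if_neg hj.symm],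
    List.count_eq_one_of_mem (List.nodup_finRange n) (List.mem_finRange i)]
  simp

theorem continuous_value : Continuous fun p : A × I => W.value p.1 p.2 := by
  have h1 : ∀ j : Fin n, Continuous fun p : A × I => scalars n A (W.path j p.2) := fun j =>
    (continuous_scalars n A).comp
      (continuous_subtype_val.comp ((W.path j).continuous.comp continuous_snd))
  have h2 : ∀ j : Fin n, Continuous fun p : A × I => oneAt j p.1 := fun j => by
    simp only [oneAt_eq]
    refine continuous_diag fun i => ?_
    split_ifs
    exacts [continuous_fst, continuous_const]
  exact continuous_list_prod _ fun j _ => ((h1 j).star.mul (h2 j)).mul (h1 j)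

/-- The function `t ↦ 𝓦(u; t)`. -/
def valuePath (u : A) : C(I, Mat n A) where
  toFun := W.value u
  continuous_toFun := by
    have h := (W.continuous_value (A := A)).comp (Continuous.prodMk_right (Y := I) u)
    exact h

theorem continuous_valuePath : Continuous (W.valuePath : A → C(I, Mat n A)) :=
  ContinuousMap.continuous_of_continuous_uncurry _ (W.continuous_value (A := A))

theorem valuePath_mem (u : A) : W.valuePath u ∈ dimensionDrop A 1 n (one_mul n) := by
  refine ⟨⟨ampl 1 A u, (W.value_zero u).trans (flatten_ampl_ampl _ _).symm⟩, W.value u 1, ?_⟩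
  have hb : ∀ p : Fin n, (blockIndex ((Nat.mul_comm n 1).trans (one_mul n)) p).2 = p :=
    fun p => Fin.ext (Nat.mod_eq_of_lt p.2)
  ext p q
  rw [flatten_apply, ampl_apply, if_pos (Subsingleton.elim _ _), hb, hb]
  rfl

/-- The map `𝓦 : U(A) → U(A ⊗ Z_{1,n})` given by a sequence of paths. -/
def elementaryMap (W : SUPaths n) (A : Type*) [CStarAlgebra A] :
    C(unitary A, UZ A 1 n (one_mul n)) where
  toFun u := mkUZ (one_mul n) (W.valuePath (u : A)) (W.valuePath_mem _) (W.value_mem_unitary u)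
  continuous_toFun := by
    have h := (W.continuous_valuePath (A := A)).comp (continuous_subtype_val (p := (· ∈ unitary A)))
    exact Continuous.subtype_mk (Continuous.subtype_mk h _) _

end SUPaths

/-- Elementary maps `U(A) → U(A ⊗ Z_{1,n})`: those given by a sequence of `n` paths in `SU_n`. -/
def IsElementary {A : Type*} [CStarAlgebra A] {n : ℕ}
    (𝓦 : C(unitary A, UZ A 1 n (one_mul n))) : Prop :=
  ∃ W : SUPaths n, 𝓦 = W.elementaryMap A

section Glue

variable {A : Type*} [CStarAlgebra A] {m n N : ℕ}

/-- The condition `f(1) = g(1)` in `M_{mn}(A)`, under which `f ∈ U(M_m(A) ⊗ Z_{1,n})` and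
`g ∈ U(M_n(A) ⊗ Z_{1,m})` can be glued; `M_n(M_m(A))` and `M_m(M_n(A))` are both identified with
`M_{mn}(A)`. -/
def Gluable (h : m * n = N) (f : UZ (Mat m A) 1 n (one_mul n))
    (g : UZ (Mat n A) 1 m (one_mul m)) : Prop :=
  flatten h A ((f : C(I, Mat n (Mat m A))) 1) =
    flatten ((Nat.mul_comm n m).trans h) A ((g : C(I, Mat m (Mat n A))) 1)

/-- The value at `t` of `f * g`: it is `f(2t)` for `t ∈ [0, 1/2]` and `g(2 - 2t)` for
`t ∈ [1/2, 1]`. (The projection `Set.projIcc` onto `[0, 1]` does not change `2t` and `2 - 2t` in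
these ranges.) -/
def glueValue (h : m * n = N) (f : UZ (Mat m A) 1 n (one_mul n))
    (g : UZ (Mat n A) 1 m (one_mul m)) (t : I) : Mat N A :=
  if (t : ℝ) ≤ 1 / 2 then
    flatten h A ((f : C(I, Mat n (Mat m A))) (Set.projIcc 0 1 zero_le_one (2 * (t : ℝ))))
  else
    flatten ((Nat.mul_comm n m).trans h) A
      ((g : C(I, Mat m (Mat n A))) (Set.projIcc 0 1 zero_le_one (2 - 2 * (t : ℝ))))

theorem continuous_glueValue (h : m * n = N) {X : Type*} [TopologicalSpace X]
    (β₀ : C(X, UZ (Mat m A) 1 n (one_mul n))) (β₁ : C(X, UZ (Mat n A) 1 m (one_mul m)))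
    (hβ : ∀ x, Gluable h (β₀ x) (β₁ x)) :
    Continuous fun p : X × I => glueValue h (β₀ p.1) (β₁ p.1) p.2 := by
  refine Continuous.if_le ?_ ?_ (by fun_prop) continuous_const ?_
  · refine (continuous_flatten _ A).comp ((UZ_continuous_eval _ _ _ _).comp
      ((β₀.continuous.comp continuous_fst).prodMk (continuous_projIcc (h := zero_le_one).comp (by fun_prop))))
  · refine (continuous_flatten _ A).comp ((UZ_continuous_eval _ _ _ _).comp
      ((β₁.continuous.comp continuous_fst).prodMk (continuous_projIcc (h := zero_le_one).comp (by fun_prop))))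
  · rintro ⟨x, t⟩ (ht : (t : ℝ) = 1 / 2)
    have e1 : Set.projIcc (0 : ℝ) 1 zero_le_one (2 * (t : ℝ)) = 1 := by
      rw [ht]; norm_num
    have e2 : Set.projIcc (0 : ℝ) 1 zero_le_one (2 - 2 * (t : ℝ)) = 1 := by
      rw [ht]; norm_num
    simp only [e1, e2]
    exact hβ x

theorem UZ_zero {B : Type*} [CStarAlgebra B] (f : UZ B 1 n (one_mul n)) :
    ∃ b : B, (f : C(I, Mat n B)) 0 = ampl n B b := by
  obtain ⟨a, ha⟩ := f.1.2.1
  refine ⟨a 0 0, ha.trans ?_⟩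
  ext p q
  have hb : ∀ p : Fin n, (blockIndex (one_mul n) p).1 = p :=
    fun p => Fin.ext (Nat.div_one _)
  rw [flatten_apply, ampl_apply, ite_mat_apply, ampl_apply, hb, hb,
    Subsingleton.elim (blockIndex (one_mul n) p).2 0,
    Subsingleton.elim (blockIndex (one_mul n) q).2 0]

theorem glueValue_mem_unitary (h : m * n = N) (f : UZ (Mat m A) 1 n (one_mul n))
    (g : UZ (Mat n A) 1 m (one_mul m)) (t : I) : glueValue h f g t ∈ unitary (Mat N A) := by
  rw [glueValue]
  split_ifs
  · exact Unitary.map_mem _ (UZ_eval_mem f _)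
  · exact Unitary.map_mem _ (UZ_eval_mem g _)

/-- For `β₀ : X → U(M_m(A) ⊗ Z_{1,n})` and `β₁ : X → U(M_n(A) ⊗ Z_{1,m})` with
`β₀(x; 1) = β₁(x; 1)` for all `x`, the map `β₀ * β₁ : X → U(A ⊗ Z_{m,n})`,
`(β₀ * β₁)(x) = β₀(x) * β₁(x)`. -/
def glue (h : m * n = N) {X : Type*} [TopologicalSpace X]
    (β₀ : C(X, UZ (Mat m A) 1 n (one_mul n))) (β₁ : C(X, UZ (Mat n A) 1 m (one_mul m)))
    (hβ : ∀ x, Gluable h (β₀ x) (β₁ x)) : C(X, UZ A m n h) where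
  toFun x := mkUZ h
    ⟨glueValue h (β₀ x) (β₁ x), 
      (continuous_glueValue h β₀ β₁ hβ).comp (Continuous.prodMk_right x)⟩
    ⟨by
      obtain ⟨a, ha⟩ := UZ_zero (β₀ x)
      refine ⟨a, ?_⟩
      rw [← ha]
      simp [glueValue], by
      obtain ⟨b, hb⟩ := UZ_zero (β₁ x)
      refine ⟨b, ?_⟩
      rw [← hb]
      have h1 : ¬ (((1 : I) : ℝ) ≤ 1 / 2) := by norm_num
      change glueValue h (β₀ x) (β₁ x) 1 = _
      rw [glueValue, if_neg h1]
      simp⟩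
    (glueValue_mem_unitary h _ _)
  continuous_toFun := by
    refine Continuous.subtype_mk (Continuous.subtype_mk ?_ _) _
    exact ContinuousMap.continuous_of_continuous_uncurry _ (continuous_glueValue h β₀ β₁ hβ)

theorem gluable_of_isElementary (h : m * n = N)
    {𝓦₀ : C(unitary (Mat m A), UZ (Mat m A) 1 n (one_mul n))}
    {𝓦₁ : C(unitary (Mat n A), UZ (Mat n A) 1 m (one_mul m))}
    (h₀ : IsElementary 𝓦₀) (h₁ : IsElementary 𝓦₁) (u : unitary A) :
    Gluable h ((𝓦₀.comp ((cornerU m A).comp (powU m A))) u)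
      ((𝓦₁.comp ((cornerU n A).comp (powU n A))) u) := by
  obtain ⟨W₀, rfl⟩ := h₀
  obtain ⟨W₁, rfl⟩ := h₁
  change flatten h A (W₀.value (corner m ((u : A) ^ m)) 1) =
    flatten _ A (W₁.value (corner n ((u : A) ^ n)) 1)
  rw [SUPaths.value_one, SUPaths.value_one, corner_pow, corner_pow, flatten_corner_corner,
    flatten_corner_corner, ← pow_mul, ← pow_mul, Nat.mul_comm]

/-- Basic maps `η : U(A) → U(A ⊗ Z_{m,n})`: those of the form
`η(u) = 𝓦₀(u^m ⊕ 1_{m-1}) * 𝓦₁(u^n ⊕ 1_{n-1})` with elementary maps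
`𝓦₀ : U(M_m(A)) → U(M_m(A) ⊗ Z_{1,n})` and `𝓦₁ : U(M_n(A)) → U(M_n(A) ⊗ Z_{1,m})`. -/
def IsBasic (h : m * n = N) (η : C(unitary A, UZ A m n h)) : Prop :=
  ∃ (𝓦₀ : C(unitary (Mat m A), UZ (Mat m A) 1 n (one_mul n)))
    (𝓦₁ : C(unitary (Mat n A), UZ (Mat n A) 1 m (one_mul m)))
    (h₀ : IsElementary 𝓦₀) (h₁ : IsElementary 𝓦₁),
    η = glue h (𝓦₀.comp ((cornerU m A).comp (powU m A)))
      (𝓦₁.comp ((cornerU n A).comp (powU n A))) (gluable_of_isElementary h h₀ h₁)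

end Glue

end DimensionDrop

end

/-!
Let `N = mn`. For a projection `p ∈ M_N` and `u ∈ U(A)`, `twist p u = (1 - p) ⊗ 1 + p ⊗ u` is a
unitary of `M_N(A)`, and for a tuple `p` of `N` projections `word p u` is the product of the
unitaries `twist (p k) u` in the order of increasing `k`. It depends continuously on `p` and `u`,
and `word p 1 = 1`.

Each value `η(u)(t)` of a basic map is `word (p(t)) u` for a path `t ↦ p(t)` of tuples of rank one
projections that does not depend on `u` (`flatten_value_corner`): for `t ≤ 1/2` the `k`-th
projection is that of `W_j^* e_j ⊗ e_0` with `j = ⌊k/m⌋`, for `t ≥ 1/2` it comes from the other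
elementary map in the same way with `⌊k/n⌋`, and at `t = 1/2` all projections are equal to `e_{0,0}`,
so that the two orderings of the factors do not conflict.

Since `ι(u) = word (e_{k,k})_k u`, it is enough to deform each path of lines, for one `k` at a time,
to the constant path at `ℂ e_k`, while respecting the boundary conditions of `Z_{m,n}(A)`. If `k` is
the position `(j, i)` in the identification of `M_N` with `M_n(M_m)`, then at `t = 0` the line
`ℂ(e_j ⊗ e_0)` is moved to `ℂ(e_j ⊗ e_i)` along the segment from `e_j ⊗ e_0` to `e_j ⊗ e_i`; the
product over all `k` then has the form `a ⊗ 1_n` throughout (`exists_word_segment_eq`). The end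
`t = 1` is treated in the same way with `M_m(M_n)`. The resulting boundary data on the square are
filled in by simple connectedness of the projective space (`exists_lineProj_square`): after lifting
to vectors the straight line homotopy has the right boundary, up to phases, but may vanish inside
the square, and since `ℂ^N` has real dimension at least `4` for `N ≥ 2`, it can be pushed off the
origin (`exists_nonvanishing_eqOn`).
-/

open scoped unitInterval

noncomputable section

namespace DimensionDrop

attribute [local instance] CStarAlgebra.spectralOrder CStarAlgebra.spectralOrderedRing

/-! ### Nonvanishing maps on the square -/

/-- A map from the square to a real vector space of dimension at least three can be made
nonvanishing without changing it on a closed set where it already is: after smoothing it, its image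
has measure zero, so that a small translate misses the origin. -/
theorem exists_nonvanishing_eqOn {F : Type*} [NormedAddCommGroup F] [NormedSpace ℝ F]
    [FiniteDimensional ℝ F] (hF : 2 < Module.finrank ℝ F) (B : C(I × I, F)) {K : Set (I × I)}
    (hK : IsClosed K) (hB : ∀ x ∈ K, B x ≠ 0) :
    ∃ H : C(I × I, F), (∀ x, H x ≠ 0) ∧ Set.EqOn H B K := by
  obtain ⟨ε, hε, hεB⟩ : ∃ ε > 0, ∀ x ∈ K, 3 * ε ≤ ‖B x‖ := by
    obtain ⟨δ, hδ, h⟩ := hK.isCompact.exists_forall_le' (f := fun x => ‖B x‖) (a := 0)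
      (by fun_prop) fun x hx => norm_pos_iff.2 (hB x hx)
    exact ⟨δ / 3, by positivity, fun x hx => by linarith [h x hx]⟩
  have hproj : UniformContinuous fun x : ℝ × ℝ => ((Set.projIcc 0 1 zero_le_one x.1,
      Set.projIcc 0 1 zero_le_one x.2) : I × I) :=
    ((LipschitzWith.projIcc _).uniformContinuous.comp uniformContinuous_fst).prodMk
      ((LipschitzWith.projIcc _).uniformContinuous.comp uniformContinuous_snd)
  obtain ⟨g, hg, hgB⟩ := ((CompactSpace.uniformContinuous_of_continuous B.continuous).comp
    hproj).exists_contDiff_dist_le (half_pos hε)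
  obtain ⟨c, hcg, hc⟩ := ((hg.of_le (by norm_cast) :
    ContDiff ℝ 1 g).dense_compl_range_of_finrank_lt_finrank
      (by simpa using hF)).exists_dist_lt 0 (half_pos hε)
  rw [dist_zero_left] at hc
  let Q : I × I → F := fun x => g (x.1, x.2) - c
  have hQ : Continuous Q := by
    have := hg.continuous
    fun_prop
  have hQ0 : ∀ x, Q x ≠ 0 := fun x hx => hcg ⟨_, sub_eq_zero.1 hx⟩
  have hQB : ∀ x, ‖B x - Q x‖ < ε := fun x => by
    have h := hgB (x.1, x.2)
    simp only [Function.comp_apply, Set.projIcc_val, dist_eq_norm'] at h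
    have e : B x - Q x = (B x - g (x.1, x.2)) + c := by simp only [Q]; abel
    rw [e]
    exact (norm_add_le _ _).trans_lt (by linarith)
  -- `θ` vanishes where `‖B‖ ≤ 2ε` and is `1` where `‖B‖ ≥ 3ε`, in particular on `K`.
  let θ : I × I → ℝ := fun x => max 0 (min 1 (‖B x‖ / ε - 2))
  have hθ : Continuous θ := by fun_prop
  refine ⟨⟨fun x => Q x + θ x • (B x - Q x), by fun_prop⟩, fun x hx => ?_, fun x hx => ?_⟩
  · simp only [ContinuousMap.coe_mk] at hx
    have h0 : 0 ≤ θ x := le_max_left _ _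
    have h1 : θ x ≤ 1 := max_le zero_le_one (min_le_left _ _)
    rcases le_or_gt ‖B x‖ (2 * ε) with h | h
    · have : θ x = 0 := max_eq_left ((min_le_right _ _).trans (by
        rw [sub_nonpos, div_le_iff₀ hε]; exact h))
      rw [this, zero_smul, add_zero] at hx
      exact hQ0 x hx
    · have e : B x = (1 - θ x) • (B x - Q x) := by
        rw [sub_smul, one_smul, ← sub_eq_zero, ← hx]
        abel
      have : ‖B x‖ ≤ ‖B x - Q x‖ := by
        conv_lhs => rw [e]
        rw [norm_smul, Real.norm_of_nonneg (by linarith)]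
        exact mul_le_of_le_one_left (norm_nonneg _) (by linarith)
      linarith [hQB x]
  · have h1 : 1 ≤ ‖B x‖ / ε - 2 := by
      rw [le_sub_iff_add_le, le_div_iff₀ hε]
      linarith [hεB x hx]
    have : θ x = 1 := by
      simp only [θ, min_eq_left h1]
      norm_num
    simp [this]

/-! ### Projections of rank one -/

/-- The orthogonal projection of `ℂ^N` onto the line spanned by `v`, as a matrix; it is `0` for
`v = 0`. -/
def lineProj {N : ℕ} (v : Fin N → ℂ) : Matrix (Fin N) (Fin N) ℂ :=
  (star v ⬝ᵥ v)⁻¹ • Matrix.vecMulVec v (star v)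

theorem lineProj_apply {N : ℕ} (v : Fin N → ℂ) (i j : Fin N) :
    lineProj v i j = (star v ⬝ᵥ v)⁻¹ * (v i * star (v j)) := rfl

open scoped ComplexOrder in
theorem star_dotProduct_self_ne_zero {N : ℕ} {v : Fin N → ℂ} (hv : v ≠ 0) : star v ⬝ᵥ v ≠ 0 :=
  fun h => hv (dotProduct_self_star_eq_zero.1 ((dotProduct_comm _ _).trans h))

theorem star_dotProduct_self_star {N : ℕ} (v : Fin N → ℂ) :
    star (star v ⬝ᵥ v) = star v ⬝ᵥ v := by
  rw [← Matrix.star_dotProduct_star, star_star, dotProduct_comm]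

theorem isStarProjection_lineProj {N : ℕ} (v : Fin N → ℂ) : IsStarProjection (lineProj v) := by
  constructor
  · rw [IsIdempotentElem, lineProj, smul_mul_smul_comm, Matrix.vecMulVec_mul_vecMulVec,
      Matrix.vecMulVec_smul, smul_smul]
    rcases eq_or_ne (star v ⬝ᵥ v) 0 with h | h
    · simp [h]
    · rw [mul_assoc, inv_mul_cancel₀ h, mul_one]
  · rw [isSelfAdjoint_iff, lineProj, star_smul, star_inv₀, star_dotProduct_self_star]
    congr 1
    ext i j
    simp [Matrix.star_apply, Matrix.vecMulVec_apply, mul_comm]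

theorem continuous_lineProj {X : Type*} [TopologicalSpace X] {N : ℕ} {f : X → Fin N → ℂ}
    (hf : Continuous f) (h0 : ∀ x, f x ≠ 0) : Continuous fun x => lineProj (f x) := by
  refine continuous_matrix fun i j => ?_
  simp only [lineProj_apply]
  refine Continuous.mul (Continuous.inv₀ ?_ fun x => star_dotProduct_self_ne_zero (h0 x)) ?_
  · exact (hf.star).dotProduct hf
  · fun_prop

theorem lineProj_smul {N : ℕ} {c : ℂ} (hc : c ≠ 0) (v : Fin N → ℂ) :
    lineProj (c • v) = lineProj v := by
  have hc' : star c ≠ 0 := star_ne_zero.2 hc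
  ext i j
  simp only [lineProj_apply, star_smul, smul_dotProduct, dotProduct_smul, Pi.smul_apply,
    smul_eq_mul, star_mul', mul_inv]
  field_simp

theorem lineProj_single {N : ℕ} (k : Fin N) :
    lineProj (Pi.single k (1 : ℂ)) = Matrix.single k k 1 := by
  ext i j
  simp only [lineProj_apply, ← Pi.single_star, Matrix.single_apply, Pi.single_apply]
  by_cases hi : i = k <;> by_cases hj : j = k <;> simp [hi, hj, Ne.symm]

/-- In dimension one there is only one projection of rank one. -/
theorem lineProj_eq_of_subsingleton {N : ℕ} [Subsingleton (Fin N)] {v w : Fin N → ℂ}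
    (hv : v ≠ 0) (hw : w ≠ 0) : lineProj v = lineProj w := by
  obtain ⟨i, hi⟩ := Function.ne_iff.1 hw
  have h : v = (v i / w i) • w := by
    ext j
    rw [Subsingleton.elim j i, Pi.smul_apply, smul_eq_mul, div_mul_cancel₀ _ hi]
  rw [h]
  refine lineProj_smul (fun h0 => hv ?_) w
  rw [h, h0, zero_smul]

/-- A vector spanning the range of a coordinate projection is a multiple of the basis vector. -/
theorem eq_smul_single_of_lineProj_eq {N : ℕ} {v : Fin N → ℂ} (hv : v ≠ 0) {k : Fin N}
    (h : lineProj v = Matrix.single k k 1) : v k ≠ 0 ∧ v = v k • Pi.single k 1 := by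
  have h0 := star_dotProduct_self_ne_zero hv
  have hz : ∀ i, i ≠ k → v i = 0 := fun i hi => by
    have := congrFun (congrFun h i) i
    rw [lineProj_apply, Matrix.single_apply, if_neg fun h => hi h.1.symm] at this
    simpa [h0] using this
  have e : v = v k • Pi.single k 1 := by
    ext i
    rcases eq_or_ne i k with rfl | hi
    · simp
    · simp [hz i hi, hi]
  refine ⟨fun hk => hv ?_, e⟩
  rw [e, hk, zero_smul]

/-- Segments between basis vectors avoid the origin. -/
theorem segment_single_ne_zero {N : ℕ} (a k : Fin N) (s : I) :
    (1 - (s : ℂ)) • Pi.single a (1 : ℂ) + (s : ℂ) • Pi.single k (1 : ℂ) ≠ 0 := by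
  intro h
  have ha := congrFun h a
  have hk := congrFun h k
  rcases eq_or_ne a k with rfl | hak
  · simp at ha
  · simp only [Pi.add_apply, Pi.smul_apply, Pi.single_eq_same, Pi.single_eq_of_ne hak,
      Pi.single_eq_of_ne hak.symm, smul_eq_mul, mul_one, mul_zero, add_zero, zero_add,
      Pi.zero_apply] at ha hk
    rw [hk] at ha
    simp at ha

/-- Any path of lines from `ℂ e_a` to `ℂ e_{a'}` can be deformed to the constant path at `ℂ e_k`
so that the ends of the paths move along the segments from `e_a` and `e_{a'}` to `e_k`. This is the
form in which the simple connectedness of projective space is used. -/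
theorem exists_lineProj_square {N : ℕ} (b : C(I, Fin N → ℂ)) (hb : ∀ t, b t ≠ 0)
    {a a' k : Fin N} {c : ℂ} (hc : c ≠ 0) (hb0 : b 0 = Pi.single a 1)
    (hb1 : b 1 = c • Pi.single a' 1) :
    ∃ h : C(I × I, Matrix (Fin N) (Fin N) ℂ), (∀ x, IsStarProjection (h x)) ∧
      (∀ t, h (0, t) = lineProj (b t)) ∧ (∀ t, h (1, t) = Matrix.single k k 1) ∧
      (∀ s : I, h (s, 0) =
        lineProj ((1 - (s : ℂ)) • Pi.single a (1 : ℂ) + (s : ℂ) • Pi.single k (1 : ℂ))) ∧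
      ∀ s : I, h (s, 1) =
        lineProj ((1 - (s : ℂ)) • Pi.single a' (1 : ℂ) + (s : ℂ) • Pi.single k (1 : ℂ)) := by
  have hk : (Pi.single k 1 : Fin N → ℂ) ≠ 0 := by simp
  suffices ∃ H : C(I × I, Fin N → ℂ), (∀ x, H x ≠ 0) ∧
      (∀ t, lineProj (H (0, t)) = lineProj (b t)) ∧
      (∀ t, lineProj (H (1, t)) = lineProj (Pi.single k 1)) ∧
      (∀ s : I, lineProj (H (s, 0)) =
        lineProj ((1 - (s : ℂ)) • Pi.single a (1 : ℂ) + (s : ℂ) • Pi.single k (1 : ℂ))) ∧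
      ∀ s : I, lineProj (H (s, 1)) =
        lineProj ((1 - (s : ℂ)) • Pi.single a' (1 : ℂ) + (s : ℂ) • Pi.single k (1 : ℂ)) by
    obtain ⟨H, hH, h1, h2, h3, h4⟩ := this
    exact ⟨⟨fun x => lineProj (H x), continuous_lineProj H.continuous hH⟩,
      fun x => isStarProjection_lineProj _, h1, fun t => (h2 t).trans (lineProj_single k), h3, h4⟩
  rcases le_or_gt N 1 with hN | hN
  · have : Subsingleton (Fin N) := Fin.subsingleton_iff_le_one.2 hN
    have key := fun v hv => lineProj_eq_of_subsingleton hk (w := v) hv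
    exact ⟨ContinuousMap.const _ (Pi.single k 1), fun _ => hk, fun t => key _ (hb t),
      fun _ => rfl, fun s => key _ (segment_single_ne_zero a k s),
      fun s => key _ (segment_single_ne_zero a' k s)⟩
  -- `γ` corrects the phase: the straight line homotopy from `b` to `γ e_k` has the right sides.
  let γ : I → ℂ := fun t => Complex.exp (t * Complex.log c)
  have hγ : Continuous γ := by fun_prop
  have hγ0 : γ 0 = 1 := by simp [γ]
  have hγ1 : γ 1 = c := by simp [γ, Complex.exp_log hc]
  let B : C(I × I, Fin N → ℂ) :=
    ⟨fun x => (1 - (x.1 : ℂ)) • b x.2 + ((x.1 : ℂ) * γ x.2) • Pi.single k 1, by fun_prop⟩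
  have B0 : ∀ t, B (0, t) = b t := fun t => by simp [B]
  have B1 : ∀ t, B (1, t) = γ t • Pi.single k 1 := fun t => by simp [B]
  have BL : ∀ s : I, B (s, 0) =
      (1 - (s : ℂ)) • Pi.single a (1 : ℂ) + (s : ℂ) • Pi.single k (1 : ℂ) := fun s => by
    simp [B, hγ0, hb0]
  have BR : ∀ s : I, B (s, 1) =
      c • ((1 - (s : ℂ)) • Pi.single a' (1 : ℂ) + (s : ℂ) • Pi.single k (1 : ℂ)) := fun s => by
    simp only [B, ContinuousMap.coe_mk, hγ1, hb1, smul_add, smul_smul, mul_comm c]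
  have hγne : ∀ t, γ t ≠ 0 := fun t => Complex.exp_ne_zero _
  obtain ⟨H, hH, hHB⟩ := exists_nonvanishing_eqOn (F := Fin N → ℂ)
    (by rw [Module.finrank_pi_fintype]; simp; omega) B
    (K := {x | x.1 = 0 ∨ x.1 = 1 ∨ x.2 = 0 ∨ x.2 = 1})
    ((isClosed_eq continuous_fst continuous_const).union
      ((isClosed_eq continuous_fst continuous_const).union
      ((isClosed_eq continuous_snd continuous_const).union
      (isClosed_eq continuous_snd continuous_const)))) (by
    rintro ⟨s, t⟩ (rfl | rfl | rfl | rfl)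
    · rw [B0]; exact hb t
    · rw [B1]; exact smul_ne_zero (hγne t) hk
    · rw [BL]; exact segment_single_ne_zero a k s
    · rw [BR]; exact smul_ne_zero hc (segment_single_ne_zero a' k s))
  refine ⟨H, hH, fun t => ?_, fun t => ?_, fun s => ?_, fun s => ?_⟩
  · rw [hHB (Or.inl rfl), B0]
  · rw [hHB (Or.inr (Or.inl rfl)), B1, lineProj_smul (hγne t)]
  · rw [hHB (Or.inr (Or.inr (Or.inl rfl))), BL]
  · rw [hHB (Or.inr (Or.inr (Or.inr rfl))), BR, lineProj_smul hc]

/-! ### Words of projections -/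

section Algebra

variable {N : ℕ} {A : Type*} [CStarAlgebra A]

/-- `(1 - p) ⊗ 1 + p ⊗ a ∈ M_N(A)`, for a projection `p ∈ M_N`. -/
def twist (p : Matrix (Fin N) (Fin N) ℂ) (a : A) : Mat N A :=
  1 + scalars N A p * ampl N A (a - 1)

theorem twist_one (p : Matrix (Fin N) (Fin N) ℂ) : twist p (1 : A) = 1 := by simp [twist]

theorem twist_mul {p : Matrix (Fin N) (Fin N) ℂ} (hp : IsIdempotentElem p) (a b : A) :
    twist p a * twist p b = twist p (a * b) := by
  have e : scalars N A p * ampl N A (a - 1) * (scalars N A p * ampl N A (b - 1)) =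
      scalars N A p * ampl N A ((a - 1) * (b - 1)) := by
    rw [mul_assoc, ← mul_assoc (ampl N A _), scalars_comm_ampl, mul_assoc, ← mul_assoc,
      ← map_mul, hp, map_mul]
  rw [twist, twist, twist, add_mul, mul_add, mul_add, e, one_mul, mul_one, one_mul, add_assoc,
    ← mul_add, ← mul_add, ← map_add, ← map_add]
  congr 4
  noncomm_ring

theorem twist_list_prod {p : Matrix (Fin N) (Fin N) ℂ} (hp : IsIdempotentElem p) (l : List A) :
    twist p l.prod = (l.map (twist p)).prod := by
  induction l with
  | nil => simp [twist_one]
  | cons a l ih => rw [List.prod_cons, ← twist_mul hp, ih, List.map_cons, List.prod_cons]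

theorem star_twist {p : Matrix (Fin N) (Fin N) ℂ} (hp : IsSelfAdjoint p) (a : A) :
    star (twist p a) = twist p (star a) := by
  rw [twist, twist, star_add, star_mul, ← map_star, ← map_star, hp.star_eq, scalars_comm_ampl,
    star_sub, star_one, star_one]

theorem twist_mem_unitary {p : Matrix (Fin N) (Fin N) ℂ} (hp : IsStarProjection p)
    (u : unitary A) : twist p (u : A) ∈ unitary (Mat N A) := by
  rw [Unitary.mem_iff, star_twist hp.isSelfAdjoint, twist_mul hp.isIdempotentElem,
    twist_mul hp.isIdempotentElem]
  simp [twist_one]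

theorem oneAt_eq_twist (j : Fin N) (a : A) : oneAt j a = twist (Matrix.single j j 1) a :=
  oneAt_scalars j a

theorem continuous_twist {X : Type*} [TopologicalSpace X] {p : X → Matrix (Fin N) (Fin N) ℂ}
    (hp : Continuous p) {f : X → A} (hf : Continuous f) :
    Continuous fun x => twist (p x) (f x) :=
  continuous_const.add (((continuous_scalars N A).comp hp).mul
    (continuous_diag fun _ => hf.sub continuous_const))

/-- The product `∏_k ((1 - p_k) ⊗ 1 + p_k ⊗ a)`, in the order of increasing `k`. -/
def word (p : Fin N → Matrix (Fin N) (Fin N) ℂ) (a : A) : Mat N A :=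
  ((List.finRange N).map fun k => twist (p k) a).prod

theorem word_one (p : Fin N → Matrix (Fin N) (Fin N) ℂ) : word p (1 : A) = 1 := by
  simp [word, twist_one]

theorem word_mem_unitary {p : Fin N → Matrix (Fin N) (Fin N) ℂ}
    (hp : ∀ k, IsStarProjection (p k)) (u : unitary A) :
    word p (u : A) ∈ unitary (Mat N A) := by
  refine list_prod_mem fun x hx => ?_
  obtain ⟨k, -, rfl⟩ := List.mem_map.1 hx
  exact twist_mem_unitary (hp k) u

theorem continuous_word {X : Type*} [TopologicalSpace X]
    {p : X → Fin N → Matrix (Fin N) (Fin N) ℂ} (hp : ∀ k, Continuous fun x => p x k)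
    {f : X → A} (hf : Continuous f) : Continuous fun x => word (p x) (f x) :=
  continuous_list_prod _ fun k _ => continuous_twist (hp k) hf

theorem prod_oneAt (a : A) :
    ((List.finRange N).map fun j => oneAt j a).prod = ampl N A a := by
  have h2 : ∀ l : List (Fin N), (l.map fun j => oneAt j a).prod =
      diag fun i => (l.map fun j => if i = j then a else 1).prod := by
    intro l
    induction l with
    | nil => simpa using diag_one.symm
    | cons j l ih =>
      rw [List.map_cons, List.prod_cons, ih, oneAt_eq, diag_mul]
      simp only [List.map_cons, List.prod_cons]
  rw [h2]
  change _ = diag fun _ => a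
  congr 1
  ext i
  rw [List.prod_map_eq_pow_single i _ fun j hj _ => by rw [if_neg hj.symm],
    List.count_eq_one_of_mem (List.nodup_finRange N) (List.mem_finRange i)]
  simp

theorem word_single (a : A) : word (fun k : Fin N => Matrix.single k k 1) a = ampl N A a := by
  simp only [word, ← oneAt_eq_twist, prod_oneAt]

end Algebra

/-! ### Tensor products -/

section Tensor

variable {k l N : ℕ} (h : k * l = N)

/-- `p ⊗ q ∈ M_{kl}` for `p ∈ M_l` and `q ∈ M_k`, where `M_{kl}` is read as `M_l(M_k)`. -/
def kron (p : Matrix (Fin l) (Fin l) ℂ) (q : Matrix (Fin k) (Fin k) ℂ) :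
    Matrix (Fin N) (Fin N) ℂ :=
  (Matrix.kroneckerMap (· * ·) p q).submatrix (blockIndex h) (blockIndex h)

theorem kron_apply (p : Matrix (Fin l) (Fin l) ℂ) (q : Matrix (Fin k) (Fin k) ℂ) (x y : Fin N) :
    kron h p q x y = p (blockIndex h x).1 (blockIndex h y).1 *
      q (blockIndex h x).2 (blockIndex h y).2 := rfl

/-- `v ⊗ w ∈ ℂ^{kl}` for `v ∈ ℂ^l` and `w ∈ ℂ^k`. -/
def tensor (v : Fin l → ℂ) (w : Fin k → ℂ) : Fin N → ℂ :=
  fun x => v (blockIndex h x).1 * w (blockIndex h x).2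

theorem tensor_single (j : Fin l) (i : Fin k) :
    tensor h (Pi.single j 1) (Pi.single i 1) = Pi.single ((blockIndex h).symm (j, i)) 1 := by
  ext x
  simp only [tensor, Pi.single_apply, Equiv.eq_symm_apply, Prod.ext_iff]
  split_ifs <;> simp_all

theorem tensor_ne_zero {v : Fin l → ℂ} {w : Fin k → ℂ} (hv : v ≠ 0) (hw : w ≠ 0) :
    tensor h v w ≠ 0 := by
  obtain ⟨j, hj⟩ := Function.ne_iff.1 hv
  obtain ⟨i, hi⟩ := Function.ne_iff.1 hw
  refine Function.ne_iff.2 ⟨(blockIndex h).symm (j, i), ?_⟩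
  simpa [tensor] using ⟨hj, hi⟩

theorem smul_tensor (c : ℂ) (v : Fin l → ℂ) (w : Fin k → ℂ) :
    tensor h (c • v) w = c • tensor h v w := by
  ext x
  simp [tensor, mul_assoc]

theorem tensor_add_smul (v : Fin l → ℂ) (w w' : Fin k → ℂ) (c c' : ℂ) :
    tensor h v (c • w + c' • w') = c • tensor h v w + c' • tensor h v w' := by
  ext x
  simp only [tensor, Pi.add_apply, Pi.smul_apply, smul_eq_mul]
  ring

theorem flatten_twist_twist {A : Type*} [CStarAlgebra A] (p : Matrix (Fin l) (Fin l) ℂ)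
    (q : Matrix (Fin k) (Fin k) ℂ) (a : A) :
    flatten h A (twist p (twist q a)) = twist (kron h p q) a := by
  rw [twist, twist, twist, add_sub_cancel_left, map_add, map_one]
  congr 1
  have e : flatten h A (scalars l (Mat k A) p * ampl l (Mat k A) (scalars k A q)) =
      scalars N A (kron h p q) := by
    ext x y
    rw [flatten_apply, scalars_apply, kron_apply]
    simp only [CStarMatrix.mul_apply, scalars_apply, ampl_apply, mul_ite, mul_zero,
      Finset.sum_ite_eq', Finset.mem_univ, if_true]
    simp only [CStarMatrix.algebraMap_apply, ite_mul, zero_mul, Finset.sum_ite_eq,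
      Finset.mem_univ, if_true, map_mul]
  rw [map_mul (ampl l (Mat k A)), ← mul_assoc, map_mul, e, flatten_ampl_ampl]

/-- Reading the positions `0, …, kl - 1` as `l` consecutive groups of `k`. -/
theorem prod_map_finRange_blockIndex {M : Type*} [Monoid M] (f : Fin l → Fin k → M) :
    ((List.finRange N).map fun x => f (blockIndex h x).1 (blockIndex h x).2).prod =
      ((List.finRange l).map fun j => ((List.finRange k).map fun i => f j i).prod).prod := by
  subst h
  rw [← List.ofFn_eq_map, List.ofFn_mul', List.prod_flatten, List.map_ofFn, List.ofFn_eq_map]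
  congr 2
  ext j
  rw [Function.comp_apply, List.ofFn_eq_map]
  congr 2
  ext i
  congr 1 <;> ext
  · change (k * (j : ℕ) + i) / k = j
    rw [Nat.mul_add_div i.pos, Nat.div_eq_of_lt i.2, add_zero]
  · change (k * (j : ℕ) + i) % k = i
    rw [Nat.mul_add_mod, Nat.mod_eq_of_lt i.2]

theorem SUPaths.mul_star_path {n : ℕ} (W : SUPaths n) (j : Fin n) (t : I) :
    (W.path j t : Matrix (Fin n) (Fin n) ℂ) * star (W.path j t : Matrix (Fin n) (Fin n) ℂ) = 1 :=
  (Unitary.mem_iff.1 (Matrix.specialUnitaryGroup_le_unitaryGroup (W.path j t).2)).2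

/-- The words that occur at the ends of the interval, where they have to lie in `M_k ⊗ 1_l`. -/
theorem word_kron_single {A : Type*} [CStarAlgebra A] (q : Fin k → Matrix (Fin k) (Fin k) ℂ)
    (a : A) :
    word (fun x => kron h (Matrix.single (blockIndex h x).1 (blockIndex h x).1 1)
      (q (blockIndex h x).2)) a = flatten h A (ampl l (Mat k A) (word q a)) := by
  rw [word, prod_map_finRange_blockIndex h fun j i => twist (kron h (Matrix.single j j 1) (q i)) a,
    ← prod_oneAt, map_list_prod, List.map_map]
  congr 2
  ext j : 1
  rw [Function.comp_apply, oneAt_eq_twist, word, twist_list_prod (by simp [IsIdempotentElem]),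
    map_list_prod, List.map_map, List.map_map]
  congr 2
  ext i : 1
  exact (flatten_twist_twist h _ _ _).symm

/-- An elementary map at `u^k ⊕ 1_{k-1}` is a word of rank one projections. -/
theorem flatten_value_corner {A : Type*} [CStarAlgebra A] (hk : 0 < k) (W : SUPaths l) (a : A)
    (t : I) : flatten h A (W.value (corner k (a ^ k)) t) =
      word (fun x => kron h (star (W.path (blockIndex h x).1 t : Matrix (Fin l) (Fin l) ℂ) *
        Matrix.single (blockIndex h x).1 (blockIndex h x).1 1 *
        (W.path (blockIndex h x).1 t : Matrix (Fin l) (Fin l) ℂ))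
        (Matrix.single ⟨0, hk⟩ ⟨0, hk⟩ 1)) a := by
  rw [word, prod_map_finRange_blockIndex h fun j _ => twist (kron h
    (star (W.path j t : Matrix (Fin l) (Fin l) ℂ) * Matrix.single j j 1 *
        (W.path j t : Matrix (Fin l) (Fin l) ℂ)) (Matrix.single ⟨0, hk⟩ ⟨0, hk⟩ 1)) a,
    SUPaths.value, map_list_prod, List.map_map]
  congr 2
  ext j : 1
  have hp : IsIdempotentElem (star (W.path j t : Matrix (Fin l) (Fin l) ℂ) *
      Matrix.single j j 1 * (W.path j t : Matrix (Fin l) (Fin l) ℂ)) := by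
    rw [IsIdempotentElem]
    simp only [mul_assoc]
    rw [← mul_assoc (W.path j t : Matrix (Fin l) (Fin l) ℂ) (star _), W.mul_star_path,
      one_mul,
      ← mul_assoc (Matrix.single j j (1 : ℂ)) (Matrix.single j j 1), Matrix.single_mul_single_same,
      one_mul]
  rw [Function.comp_apply, SUPaths.factor_eq, ← twist, ← corner_pow, List.map_const',
    List.prod_replicate, List.length_finRange, ← flatten_twist_twist, ← map_pow, corner_eq hk,
    oneAt_eq_twist, ← List.prod_replicate, twist_list_prod hp, List.map_replicate,
    List.prod_replicate]

end Tensor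

/-! ### Basic maps as words of rank one projections -/

section Basic

theorem lineProj_tensor {k l N : ℕ} (h : k * l = N) (v : Fin l → ℂ) (w : Fin k → ℂ) :
    lineProj (tensor h v w) = kron h (lineProj v) (lineProj w) := by
  have e : star (tensor h v w) ⬝ᵥ tensor h v w = (star v ⬝ᵥ v) * (star w ⬝ᵥ w) := by
    simp only [dotProduct, Finset.sum_mul_sum, ← Fintype.sum_prod_type']
    rw [← (blockIndex h).sum_comp]
    refine Finset.sum_congr rfl fun x _ => ?_
    simp only [tensor, Pi.star_apply, star_mul']
    ring
  ext x y
  rw [lineProj_apply, kron_apply, lineProj_apply, lineProj_apply, e, mul_inv]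
  simp only [tensor, star_mul']
  ring

/-- The vector `W_j(t)^* e_j`, which spans the range of `W_j(t)^* e_{j,j} W_j(t)`. -/
def SUPaths.vec {n : ℕ} (W : SUPaths n) (j : Fin n) (t : I) : Fin n → ℂ :=
  fun a => star ((W.path j t : Matrix (Fin n) (Fin n) ℂ) j a)

theorem SUPaths.continuous_vec {n : ℕ} (W : SUPaths n) (j : Fin n) : Continuous (W.vec j) :=
  continuous_pi fun a => ((continuous_subtype_val.comp (W.path j).continuous).matrix_elem j a).star

theorem SUPaths.star_vec_dotProduct {n : ℕ} (W : SUPaths n) (j : Fin n) (t : I) :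
    star (W.vec j t) ⬝ᵥ W.vec j t = 1 := by
  have := congrFun (congrFun (W.mul_star_path j t) j) j
  rw [Matrix.one_apply_eq] at this
  simpa [Matrix.mul_apply, dotProduct, SUPaths.vec] using this

theorem SUPaths.vec_ne_zero {n : ℕ} (W : SUPaths n) (j : Fin n) (t : I) : W.vec j t ≠ 0 := by
  intro h
  have := W.star_vec_dotProduct j t
  rw [h, dotProduct_zero] at this
  exact zero_ne_one this

theorem SUPaths.lineProj_vec {n : ℕ} (W : SUPaths n) (j : Fin n) (t : I) :
    lineProj (W.vec j t) = star (W.path j t : Matrix (Fin n) (Fin n) ℂ) * Matrix.single j j 1 *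
      (W.path j t : Matrix (Fin n) (Fin n) ℂ) := by
  ext a b
  rw [lineProj_apply, W.star_vec_dotProduct, inv_one, one_mul, mul_assoc, Matrix.mul_apply,
    Finset.sum_eq_single j, Matrix.single_mul_apply_same, one_mul, Matrix.star_apply]
  · simp [SUPaths.vec]
  · intro c _ hc
    rw [Matrix.single_mul_apply_of_ne _ _ _ _ _ hc, mul_zero]
  · simp

theorem SUPaths.vec_zero {n : ℕ} (W : SUPaths n) (j : Fin n) : W.vec j 0 = Pi.single j 1 := by
  ext a
  rw [SUPaths.vec, W.path_zero, OneMemClass.coe_one, Matrix.one_apply, Pi.single_apply]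
  split_ifs <;> simp_all

theorem SUPaths.vec_one {n : ℕ} (W : SUPaths n) (j : Fin n) :
    ∃ c : ℂ, c ≠ 0 ∧ W.vec j 1 = c • Pi.single ⟨0, j.pos⟩ 1 :=
  ⟨_, eq_smul_single_of_lineProj_eq (W.vec_ne_zero j 1)
    ((W.lineProj_vec j 1).trans (W.path_one j))⟩

theorem blockIndex_symm_zero {k l N : ℕ} (h : k * l = N) (hk : 0 < k) (hl : 0 < l) (hN : 0 < N) :
    (blockIndex h).symm (⟨0, hl⟩, ⟨0, hk⟩) = ⟨0, hN⟩ := by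
  ext
  simp [blockIndex]

variable {m n N : ℕ}

/-- The lines whose projections make up a basic map, lifted to a path of vectors: the two halves
are given by the two elementary maps, and agree in the middle after a change of phase. -/
theorem exists_lift_path (h : m * n = N) (hm : 0 < m) (hn : 0 < n) (W₀ : SUPaths n)
    (W₁ : SUPaths m) (x : Fin N) :
    ∃ (b : C(I, Fin N → ℂ)) (c : ℂ), (∀ t, b t ≠ 0) ∧ c ≠ 0 ∧
      b 0 = Pi.single ((blockIndex h).symm ((blockIndex h x).1, ⟨0, hm⟩)) 1 ∧
      b 1 = c • Pi.single ((blockIndex ((Nat.mul_comm n m).trans h)).symm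
        ((blockIndex ((Nat.mul_comm n m).trans h) x).1, ⟨0, hn⟩)) 1 ∧
      ∀ t : I, lineProj (b t) =
        if (t : ℝ) ≤ 1 / 2 then
          lineProj (tensor h (W₀.vec (blockIndex h x).1
            (Set.projIcc 0 1 zero_le_one (2 * (t : ℝ)))) (Pi.single ⟨0, hm⟩ 1))
        else
          lineProj (tensor ((Nat.mul_comm n m).trans h)
            (W₁.vec (blockIndex ((Nat.mul_comm n m).trans h) x).1
            (Set.projIcc 0 1 zero_le_one (2 - 2 * (t : ℝ)))) (Pi.single ⟨0, hn⟩ 1)) := by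
  set h' := (Nat.mul_comm n m).trans h
  set j := (blockIndex h x).1
  set i := (blockIndex h' x).1
  obtain ⟨c₀, hc₀, e₀⟩ := W₀.vec_one j
  obtain ⟨c₁, hc₁, e₁⟩ := W₁.vec_one i
  have hc : c₀ / c₁ ≠ 0 := div_ne_zero hc₀ hc₁
  have hcont : ∀ {k l : ℕ} (hk : k * l = N) (w : Fin k → ℂ),
      Continuous fun v : Fin l → ℂ => tensor hk v w := fun hk w =>
    continuous_pi fun y => (continuous_apply _).mul continuous_const
  refine ⟨⟨fun t : I => if (t : ℝ) ≤ 1 / 2 then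
      tensor h (W₀.vec j (Set.projIcc 0 1 zero_le_one (2 * (t : ℝ)))) (Pi.single ⟨0, hm⟩ 1)
    else (c₀ / c₁) • tensor h' (W₁.vec i (Set.projIcc 0 1 zero_le_one (2 - 2 * (t : ℝ))))
      (Pi.single ⟨0, hn⟩ 1), ?_⟩, c₀ / c₁, fun t => ?_, hc, ?_, ?_, fun t => ?_⟩
  · refine Continuous.if_le ?_ ?_ (by fun_prop) continuous_const ?_
    · exact (hcont _ _).comp ((W₀.continuous_vec j).comp
        (continuous_projIcc.comp (f := fun t : I => 2 * (t : ℝ)) (by fun_prop)))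
    · refine Continuous.const_smul ?_ (c₀ / c₁)
      exact (hcont _ _).comp ((W₁.continuous_vec i).comp
        (continuous_projIcc.comp (f := fun t : I => 2 - 2 * (t : ℝ)) (by fun_prop)))
    · intro t ht
      have t₀ : Set.projIcc (0 : ℝ) 1 zero_le_one (2 * (t : ℝ)) = 1 := by
        rw [ht]; norm_num
      have t₁ : Set.projIcc (0 : ℝ) 1 zero_le_one (2 - 2 * (t : ℝ)) = 1 := by
        rw [ht]; norm_num
      rw [t₀, t₁, e₀, e₁, smul_tensor, smul_tensor, smul_smul, div_mul_cancel₀ _ hc₁,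
        tensor_single, tensor_single, blockIndex_symm_zero h hm hn x.pos,
        blockIndex_symm_zero h' hn hm x.pos]
  · simp only [ContinuousMap.coe_mk]
    split_ifs
    · exact tensor_ne_zero _ (W₀.vec_ne_zero _ _) (by simp)
    · exact smul_ne_zero hc (tensor_ne_zero _ (W₁.vec_ne_zero _ _) (by simp))
  · simp [W₀.vec_zero, tensor_single]
  · have : ¬ (((1 : I) : ℝ) ≤ 1 / 2) := by norm_num
    simp only [ContinuousMap.coe_mk, if_neg this]
    simp [W₁.vec_zero, tensor_single]
  · simp only [ContinuousMap.coe_mk]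
    split_ifs
    · rfl
    · exact lineProj_smul hc _

/-- Words along the segments from `e_j ⊗ e_0` to `e_j ⊗ e_i` have the form `b ⊗ 1_l`. -/
theorem exists_word_segment_eq {k l : ℕ} (h : k * l = N) (hk : 0 < k) {A : Type*}
    [CStarAlgebra A] (s : I) (a : A) : ∃ b : Mat k A,
    word (fun x => lineProj ((1 - (s : ℂ)) •
      Pi.single ((blockIndex h).symm ((blockIndex h x).1, ⟨0, hk⟩)) (1 : ℂ) +
        (s : ℂ) • Pi.single x (1 : ℂ))) a = flatten h A (ampl l (Mat k A) b) := by
  refine ⟨_, Eq.trans ?_ (word_kron_single h (fun i : Fin k => lineProj ((1 - (s : ℂ)) •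
    Pi.single ⟨0, hk⟩ (1 : ℂ) + (s : ℂ) • Pi.single i (1 : ℂ))) a)⟩
  congr 1
  ext1 x
  rw [← lineProj_single, ← lineProj_tensor, tensor_add_smul, tensor_single, tensor_single,
    Prod.mk.eta, Equiv.symm_apply_apply]

/-- A square of tuples of projections whose words satisfy the boundary conditions of `Z_{m,n}(A)`
gives a homotopy between maps `U(A) → U(Z_{m,n}(A))`. -/
theorem homotopicRel_of_word {A : Type*} [CStarAlgebra A] (h : m * n = N)
    (p : Fin N → C(I × I, Matrix (Fin N) (Fin N) ℂ)) (hp : ∀ k x, IsStarProjection (p k x))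
    (hp0 : ∀ (s : I) (u : A), ∃ a : Mat m A,
      word (fun k => p k (s, 0)) u = flatten h A (ampl n (Mat m A) a))
    (hp1 : ∀ (s : I) (u : A), ∃ b : Mat n A,
      word (fun k => p k (s, 1)) u =
        flatten ((Nat.mul_comm n m).trans h) A (ampl m (Mat n A) b))
    (f g : C(unitary A, UZ A m n h))
    (hf : ∀ u t, (f u : C(I, Mat N A)) t = word (fun k => p k (0, t)) (u : A))
    (hg : ∀ u t, (g u : C(I, Mat N A)) t = word (fun k => p k (1, t)) (u : A)) :
    ContinuousMap.HomotopicRel f g {1} := by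
  have hc : Continuous fun x : (I × unitary A) × I =>
      word (fun k => p k (x.1.1, x.2)) (x.1.2 : A) :=
    continuous_word (fun k => by fun_prop) (by fun_prop)
  let H : I × unitary A → UZ A m n h := fun x => mkUZ h
    ⟨fun t => word (fun k => p k (x.1, t)) (x.2 : A),
      continuous_word (fun k => by fun_prop) continuous_const⟩
    ⟨hp0 x.1 x.2, hp1 x.1 x.2⟩ fun t => word_mem_unitary (fun k => hp k _) x.2
  have hH : Continuous H := Continuous.subtype_mk (Continuous.subtype_mk
    (ContinuousMap.continuous_of_continuous_uncurry _ hc) _) _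
  have ext_UZ : ∀ {v w : UZ A m n h},
      (∀ t, (v : C(I, Mat N A)) t = (w : C(I, Mat N A)) t) → v = w := fun hvw =>
    Subtype.ext (Subtype.ext (ContinuousMap.ext hvw))
  refine ⟨⟨⟨⟨H, hH⟩, fun u => ext_UZ fun t => (hf u t).symm,
    fun u => ext_UZ fun t => (hg u t).symm⟩, ?_⟩⟩
  rintro s u rfl
  refine ext_UZ fun t => ?_
  change word (fun k => p k (s, t)) (1 : A) = (f 1 : C(I, Mat N A)) t
  rw [hf, OneMemClass.coe_one, word_one, word_one]

end Basic

end DimensionDrop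

end

open DimensionDrop in
theorem proposition2p5 {A : Type*} [CStarAlgebra A] (m n : ℕ) (hm : 0 < m) (hn : 0 < n)
    (hmn : Nat.Coprime m n)
    (η : C(unitary A, DimensionDrop.UZ A m n rfl)) (hη : DimensionDrop.IsBasic rfl η) :
    ContinuousMap.HomotopicRel η (DimensionDrop.iota A m n rfl) {1} := by
  obtain ⟨_, _, ⟨W₀, rfl⟩, ⟨W₁, rfl⟩, rfl⟩ := hη
  choose b c hb hc hb0 hb1 hbW using exists_lift_path rfl hm hn W₀ W₁
  choose p hp hp0 hp1 hpL hpR using fun x =>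
    exists_lineProj_square (b x) (hb x) (k := x) (hc x) (hb0 x) (hb1 x)
  refine homotopicRel_of_word rfl p hp (fun s u => ?_) (fun s u => ?_) _ _
    (fun u t => ?_) fun u t => ?_
  · simp only [hpL]
    exact exists_word_segment_eq rfl hm s u
  · simp only [hpR]
    exact exists_word_segment_eq _ hn s u
  · simp only [hp0, hbW]
    change glueValue rfl _ _ t = _
    rw [glueValue]
    split_ifs with ht
    · simp only [lineProj_tensor, W₀.lineProj_vec, lineProj_single]
      exact flatten_value_corner rfl hm W₀ (u : A) _
    · simp only [lineProj_tensor, W₁.lineProj_vec, lineProj_single]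
      exact flatten_value_corner _ hn W₁ (u : A) _
  · simp only [hp1]
    exact (word_single (u : A)).symm
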